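/- All graphs are finite, simple and undirected. For a graph $H$, a graph is $H$-free if it has no induced subgraph isomorphic to $H$; $\overline{H}$ is the complement of $H$, $+$ is disjoint union, $P_n$, $C_n$, $K_n$ are the path, cycle and complete graph on $n$ vertices, and the diamond is $K_4$ minus one edge. A graph $G=(V,E)$ is probe diamond-free if $V$ can be partitioned into (possibly empty) sets $P$ and $N$ with $N$ independent, such that for some set $F$ of non-edges of $G$ with both endpoints in $N$ the graph $(V,E\cup F)$ is diamond-free. A graph is complete split, with complete split partition $(K,S)$, if its vertex set is the disjoint union of a clique $K$ and a maximum independent set $S$ such that every vertex of $K$ is adjacent to every vertex of $S$. A graph $G$ is LUCS if for every vertex $v$ each connected component of $G[N(v)]$ is complete split. Such a component $C$, with complete split partition $(K_C,S_C)$, is special if $|S_C|=1$ (i.e. $C$ is complete); for a non-special component the partition is unique. Let $F_G$ be the set of non-edges $xy$ of $G$ (with $x\neq y$) such that $x,y\in S_C$ for some vertex $w$ and some connected component $C$ of $G[N(w)]$, and let $N_G$ be the set of all endpoints of the pairs in $F_G$. For a bijection $\phi:V(G)\to\{0,\dots,|V(G)|-1\}$, the auxiliary bipartite graph $G_B=G_B^\phi$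 is defined as follows. For each vertex $v$ and each non-special component $C$ of $G[N(v)]$ with $\phi(v)<\phi(x)$ for all $x\in K_C$, it has a vertex $a_{vw}$, where $w$ is the vertex of $K_C$ with minimum $\phi$-value, and $a_{vw}$ is joined to every vertex of $S_C$. Its vertex set consists of all these new vertices $a_{vw}$ on one side and the union of the corresponding sets $S_C$ on the other, and it has no other edges. Theorem. Let $G$ be a graph and let $\phi:V(G)\to\{0,\dots,|V(G)|-1\}$ be any bijection. Then $G$ is probe diamond-free if and only if all of the following hold: $G$ is LUCS; $G$ is $\overline{P_3+K_2}$-free; $N_G$ is an independent set of $G$; and $G_B^\phi$ is $C_6$-free. -/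

import Mathlib

namespace ProbeDiamond

open SimpleGraph

/-- `G` is `H`-free: no induced subgraph of `G` is isomorphic to `H`. -/
def IsFree {V W : Type*} (H : SimpleGraph W) (G : SimpleGraph V) : Prop :=
  ¬ H.IsIndContained G

/-- The diamond `K₄ - e`. -/
def diamond : SimpleGraph (Fin 4) :=
  (⊤ : SimpleGraph (Fin 4)).deleteEdges {s(0, 1)}

/-- The complement of the disjoint union `P₃ + K₂`. -/
def coP3K2 : SimpleGraph (Fin 3 ⊕ Fin 2) :=
  (pathGraph 3 ⊕g (⊤ : SimpleGraph (Fin 2)))ᶜ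

/-- `G` is probe-`𝒢`: the vertex set is partitioned into a set `P` of probes and an independent
set `N` of nonprobes (either of which may be empty), and there is a set `F` of non-edges of `G`
with both endpoints in `N` such that adding the edges in `F` to `G` gives a graph in `𝒢`. -/
def IsProbe {V : Type*} (𝒢 : SimpleGraph V → Prop) (G : SimpleGraph V) : Prop :=
  ∃ P N : Set V, P ∪ N = Set.univ ∧ Disjoint P N ∧ G.IsIndepSet N ∧
    ∃ F : Set (Sym2 V),
      (∀ e ∈ F, ¬ e.IsDiag ∧ e ∉ G.edgeSet ∧ ∀ x ∈ e, x ∈ N) ∧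
      𝒢 (G ⊔ fromEdgeSet F)

/-- Probe diamond-free graphs (no probe partition prescribed). -/
def IsProbeDiamondFree {V : Type*} (G : SimpleGraph V) : Prop :=
  IsProbe (fun H : SimpleGraph V => IsFree diamond H) G

/-- `(K, S)` is a complete split partition of the induced subgraph `G[A]`: `A` is the disjoint
union of the clique `K` and the set `S`, which is a maximum independent set of `G[A]`,
and every vertex of `K` is adjacent to every vertex of `S`. -/
structure IsCompleteSplitPartition {V : Type*} (G : SimpleGraph V) (A K S : Set V) : Prop where
  union_eq : K ∪ S = A
  disjoint : Disjoint K S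
  isClique : G.IsClique K
  isIndepSet : G.IsIndepSet S
  maximum : ∀ T : Set V, T ⊆ A → G.IsIndepSet T → T.encard ≤ S.encard
  complete : ∀ x ∈ K, ∀ y ∈ S, G.Adj x y

/-- The induced subgraph `G[A]` is a complete split graph. -/
def IsCompleteSplit {V : Type*} (G : SimpleGraph V) (A : Set V) : Prop :=
  ∃ K S : Set V, IsCompleteSplitPartition G A K S

/-- The vertex sets of the connected components of `G[N(v)]`. -/
def localComponents {V : Type*} (G : SimpleGraph V) (v : V) : Set (Set V) :=
  {A | ∃ c : (G.induce (G.neighborSet v)).ConnectedComponent, A = Subtype.val '' c.supp}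

/-- `G` is locally union of complete split. -/
def IsLUCS {V : Type*} (G : SimpleGraph V) : Prop :=
  ∀ v : V, ∀ A ∈ localComponents G v, IsCompleteSplit G A

/-- The set `F_G` of the non-edges `uv` of `G` such that `u` and `v` lie in the independent part
of the complete split partition of one connected component of some `G[N(w)]`. -/
def tipPairs {V : Type*} (G : SimpleGraph V) : Set (Sym2 V) :=
  {e | ∃ u v : V, e = s(u, v) ∧ u ≠ v ∧ ¬ G.Adj u v ∧
    ∃ w : V, ∃ A ∈ localComponents G w, ∃ K S : Set V,
      IsCompleteSplitPartition G A K S ∧ u ∈ S ∧ v ∈ S}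

/-- The set `N_G` of the endpoints of the pairs in `F_G`. -/
def tipSet {V : Type*} (G : SimpleGraph V) : Set V :=
  {x | ∃ e ∈ tipPairs G, x ∈ e}

/-- There is a non-special component `C` (that is, `|S| ≠ 1`) of `G[N(v)]` with complete split
partition `(K, S)` such that `v` precedes every vertex of `K` in the ordering `φ`, and `w` is the
first vertex of `K`. Each such pair `(v, w)` gives one vertex `a_{vw}` of the auxiliary
bipartite graph, with neighbourhood `S`. -/
def IsRepresented {V : Type*} [Fintype V] (G : SimpleGraph V) (φ : V ≃ Fin (Fintype.card V))
    (v w : V) (S : Set V) : Prop :=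
  ∃ A ∈ localComponents G v, ∃ K : Set V,
    IsCompleteSplitPartition G A K S ∧ S.encard ≠ 1 ∧
    (∀ x ∈ K, φ v < φ x) ∧ w ∈ K ∧ ∀ x ∈ K, φ w ≤ φ x

/-- The vertices `a_{vw}` of the auxiliary bipartite graph. -/
def auxA {V : Type*} [Fintype V] (G : SimpleGraph V) (φ : V ≃ Fin (Fintype.card V)) :
    Set (V × V) :=
  {p | ∃ S : Set V, IsRepresented G φ p.1 p.2 S}

/-- The other side of the auxiliary bipartite graph: the union of the sets `S`. -/
def auxN {V : Type*} [Fintype V] (G : SimpleGraph V) (φ : V ≃ Fin (Fintype.card V)) :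
    Set V :=
  {s | ∃ v w : V, ∃ S : Set V, IsRepresented G φ v w S ∧ s ∈ S}

/-- `a_{vw}` is joined to `s`. -/
def auxRel {V : Type*} [Fintype V] (G : SimpleGraph V) (φ : V ≃ Fin (Fintype.card V))
    (a : auxA G φ) (s : auxN G φ) : Prop :=
  ∃ S : Set V, IsRepresented G φ a.1.1 a.1.2 S ∧ s.1 ∈ S

/-- The auxiliary bipartite graph `G_B`, built with the ordering `φ`. -/
def auxGraph {V : Type*} [Fintype V] (G : SimpleGraph V) (φ : V ≃ Fin (Fintype.card V)) :
    SimpleGraph (auxA G φ ⊕ auxN G φ) where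
  Adj
    | Sum.inl a, Sum.inr s => auxRel G φ a s
    | Sum.inr s, Sum.inl a => auxRel G φ a s
    | _, _ => False
  symm := ⟨by rintro (a | s) (b | t) h <;> exact h⟩
  loopless := ⟨by rintro (a | s) h <;> exact h⟩

end ProbeDiamond

namespace ProbeDiamond

open SimpleGraph

variable {V : Type*} {G : SimpleGraph V}

/-! ### Forbidden induced subgraphs in terms of vertices -/

theorem diamond_isIndContained_iff :
    diamond.IsIndContained G ↔ ∃ a b c d, a ≠ b ∧ ¬ G.Adj a b ∧ G.Adj a c ∧ G.Adj a d ∧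
      G.Adj b c ∧ G.Adj b d ∧ G.Adj c d := by
  constructor
  · rintro ⟨f⟩
    have h : ∀ i j, G.Adj (f i) (f j) ↔ diamond.Adj i j := fun i j => f.map_adj_iff
    refine ⟨f 0, f 1, f 2, f 3, f.injective.ne (by decide), ?_⟩
    refine ⟨mt (h _ _).1 ?_, (h _ _).2 ?_, (h _ _).2 ?_, (h _ _).2 ?_, (h _ _).2 ?_,
      (h _ _).2 ?_⟩ <;> simp [diamond]
  · rintro ⟨a, b, c, d, hne, hab, hac, had, hbc, hbd, hcd⟩
    refine ⟨⟨⟨![a, b, c, d], ?_⟩, ?_⟩⟩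
    · intro i j
      have := hac.ne; have := had.ne; have := hbc.ne; have := hbd.ne; have := hcd.ne
      fin_cases i <;> fin_cases j <;> simp_all [eq_comm]
    · intro i j
      have := hac.symm; have := had.symm; have := hbc.symm; have := hbd.symm; have := hcd.symm
      have : ¬ G.Adj b a := fun h => hab h.symm
      change G.Adj (![a, b, c, d] i) (![a, b, c, d] j) ↔ _
      fin_cases i <;> fin_cases j <;> simp [diamond, *]

theorem coP3K2_isIndContained {w d x s t : V} (hwx : G.Adj w x) (hdw : d ≠ w) (hdx : d ≠ x)
    (hndw : ¬ G.Adj d w) (hndx : ¬ G.Adj d x) (hst : s ≠ t) (hnst : ¬ G.Adj s t)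
    (hs : G.Adj w s ∧ G.Adj d s ∧ G.Adj x s) (ht : G.Adj w t ∧ G.Adj d t ∧ G.Adj x t) :
    coP3K2.IsIndContained G := by
  obtain ⟨h1, h2, h3⟩ := hs
  obtain ⟨h4, h5, h6⟩ := ht
  refine ⟨⟨⟨Sum.elim ![w, d, x] ![s, t], ?_⟩, ?_⟩⟩
  · have := hwx.ne; have := h1.ne; have := h2.ne; have := h3.ne; have := h4.ne
    have := h5.ne; have := h6.ne
    rintro (i | i) (j | j) <;> fin_cases i <;> fin_cases j <;> simp_all [eq_comm]
  · have := hwx.symm; have := h1.symm; have := h2.symm; have := h3.symm; have := h4.symm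
    have := h5.symm; have := h6.symm
    have : ¬ G.Adj w d := fun h => hndw h.symm
    have : ¬ G.Adj x d := fun h => hndx h.symm
    have : ¬ G.Adj t s := fun h => hnst h.symm
    intro i j
    change G.Adj (Sum.elim ![w, d, x] ![s, t] i) (Sum.elim ![w, d, x] ![s, t] j) ↔ _
    rcases i with i | i <;> rcases j with j | j <;> fin_cases i <;> fin_cases j <;>
      simp [coP3K2, pathGraph_adj, *]

theorem exists_of_coP3K2_isIndContained (h : coP3K2.IsIndContained G) :
    ∃ a b d e, a ≠ b ∧ ¬ G.Adj a b ∧ ¬ G.Adj d e ∧ d ≠ e ∧ G.Adj a d ∧ G.Adj a e ∧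
      G.Adj b d ∧ G.Adj b e ∧ ∃ c, G.Adj c a ∧ G.Adj c d ∧ G.Adj c e := by
  obtain ⟨f⟩ := h
  have h : ∀ i j, G.Adj (f i) (f j) ↔ coP3K2.Adj i j := fun i j => f.map_adj_iff
  refine ⟨f (.inl 0), f (.inl 1), f (.inr 0), f (.inr 1), f.injective.ne (by decide),
    mt (h _ _).1 ?_, mt (h _ _).1 ?_, f.injective.ne (by decide), (h _ _).2 ?_, (h _ _).2 ?_,
    (h _ _).2 ?_, (h _ _).2 ?_, f (.inl 2), (h _ _).2 ?_, (h _ _).2 ?_, (h _ _).2 ?_⟩ <;>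
  simp [coP3K2, pathGraph_adj]

theorem cycleGraph_six_isIndContained_auxGraph_iff [Fintype V]
    {φ : V ≃ Fin (Fintype.card V)} :
    (cycleGraph 6).IsIndContained (auxGraph G φ) ↔
      ∃ (a : Fin 3 → auxA G φ) (s : Fin 3 → auxN G φ),
        ∀ i j, auxRel G φ (a i) (s j) ↔ i ≠ j := by
  constructor
  · rintro ⟨f⟩
    have h : ∀ i j, (auxGraph G φ).Adj (f i) (f j) ↔ (cycleGraph 6).Adj i j :=
      fun i j => f.map_adj_iff
    have hr : ∀ {i j x}, f i = .inl x → (cycleGraph 6).Adj i j → ∃ y, f j = .inr y := by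
      intro i j x hx hij
      rw [← h, hx] at hij
      rcases hj : f j with y | y
      · rw [hj] at hij; exact hij.elim
      · exact ⟨y, rfl⟩
    have hl : ∀ {i j x}, f i = .inr x → (cycleGraph 6).Adj i j → ∃ y, f j = .inl y := by
      intro i j x hx hij
      rw [← h, hx] at hij
      rcases hj : f j with y | y
      · exact ⟨y, rfl⟩
      · rw [hj] at hij; exact hij.elim
    have hrel : ∀ {i j x y}, f i = .inl x → f j = .inr y →
        (auxRel G φ x y ↔ (cycleGraph 6).Adj i j) := by
      intro i j x y hx hy
      rw [← h, hx, hy]; rfl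
    rcases h0 : f 0 with x0 | x0
    · obtain ⟨x1, h1⟩ := hr h0 (j := 1) (by decide)
      obtain ⟨x2, h2⟩ := hl h1 (j := 2) (by decide)
      obtain ⟨x3, h3⟩ := hr h2 (j := 3) (by decide)
      obtain ⟨x4, h4⟩ := hl h3 (j := 4) (by decide)
      obtain ⟨x5, h5⟩ := hr h4 (j := 5) (by decide)
      have ha : ∀ i : Fin 3, f (![0, 4, 2] i) = .inl (![x0, x4, x2] i) := by
        intro i; fin_cases i <;> assumption
      have hs : ∀ i : Fin 3, f (![3, 1, 5] i) = .inr (![x3, x1, x5] i) := by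
        intro i; fin_cases i <;> assumption
      refine ⟨_, _, fun i j => (hrel (ha i) (hs j)).trans ?_⟩
      revert i j; decide
    · obtain ⟨x1, h1⟩ := hl h0 (j := 1) (by decide)
      obtain ⟨x2, h2⟩ := hr h1 (j := 2) (by decide)
      obtain ⟨x3, h3⟩ := hl h2 (j := 3) (by decide)
      obtain ⟨x4, h4⟩ := hr h3 (j := 4) (by decide)
      obtain ⟨x5, h5⟩ := hl h4 (j := 5) (by decide)
      have ha : ∀ i : Fin 3, f (![1, 5, 3] i) = .inl (![x1, x5, x3] i) := by
        intro i; fin_cases i <;> assumption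
      have hs : ∀ i : Fin 3, f (![4, 2, 0] i) = .inr (![x4, x2, x0] i) := by
        intro i; fin_cases i <;> assumption
      refine ⟨_, _, fun i j => (hrel (ha i) (hs j)).trans ?_⟩
      revert i j; decide
  · rintro ⟨a, s, h⟩
    set g : Fin 6 → auxA G φ ⊕ auxN G φ :=
      ![.inl (a 0), .inr (s 1), .inl (a 2), .inr (s 0), .inl (a 1), .inr (s 2)] with hg
    have hadj : ∀ i j, (auxGraph G φ).Adj (g i) (g j) ↔ (cycleGraph 6).Adj i j := by
      intro i j
      fin_cases i <;> fin_cases j <;> simp [hg, auxGraph, h, cycleGraph_adj] <;> decide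
    refine ⟨⟨⟨g, fun i j hij => ?_⟩, fun {i j} => hadj i j⟩⟩
    have key : ∀ k, (cycleGraph 6).Adj i k ↔ (cycleGraph 6).Adj j k := by
      intro k; rw [← hadj, ← hadj, hij]
    revert i j; clear h hadj hg
    have : ∀ i j : Fin 6,
        (∀ k, (cycleGraph 6).Adj i k ↔ (cycleGraph 6).Adj j k) → i = j := by decide
    exact fun i j _ hk => this i j hk

/-! ### Components of neighbourhoods -/

section localComponents

variable {v : V} {A : Set V}

theorem adj_of_mem_localComponents (hA : A ∈ localComponents G v) {x : V} (hx : x ∈ A) :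
    G.Adj v x := by
  obtain ⟨c, rfl⟩ := hA
  obtain ⟨y, -, rfl⟩ := hx
  exact y.2

theorem nonempty_of_mem_localComponents (hA : A ∈ localComponents G v) : A.Nonempty := by
  obtain ⟨c, rfl⟩ := hA
  exact c.nonempty_supp.image _

theorem mem_of_adj_of_mem_localComponents (hA : A ∈ localComponents G v) {x y : V}
    (hx : x ∈ A) (hy : G.Adj v y) (hxy : G.Adj x y) : y ∈ A := by
  obtain ⟨c, rfl⟩ := hA
  obtain ⟨x, hx, rfl⟩ := hx
  refine ⟨⟨y, hy⟩, ?_, rfl⟩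
  exact ConnectedComponent.mem_supp_of_adj_mem_supp c hx (by simpa using hxy)

theorem exists_mem_localComponents {x : V} (hx : G.Adj v x) :
    ∃ A ∈ localComponents G v, x ∈ A :=
  ⟨_, ⟨(G.induce (G.neighborSet v)).connectedComponentMk ⟨x, hx⟩, rfl⟩, ⟨x, hx⟩, rfl, rfl⟩

theorem localComponents_induction (hA : A ∈ localComponents G v) {p : V → Prop} {x : V}
    (hx : x ∈ A) (hpx : p x) (step : ∀ y ∈ A, ∀ z ∈ A, p y → G.Adj y z → p z) :
    ∀ y ∈ A, p y := by
  obtain ⟨c, hc⟩ := id hA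
  subst hc
  rintro _ ⟨y, hy, rfl⟩
  obtain ⟨x, hx, rfl⟩ := hx
  obtain ⟨w⟩ := ConnectedComponent.exact (hx.trans hy.symm : _)
  induction w with
  | nil => exact hpx
  | @cons u u' _ h w ih =>
    have hu' : u' ∈ c.supp := ConnectedComponent.mem_supp_of_adj_mem_supp c hx h
    exact ih hy hu' (step _ ⟨_, hx, rfl⟩ _ ⟨_, hu', rfl⟩ hpx h)

end localComponents

/-! ### Tip pairs -/

/-- A tip pair consists of the tips of an induced diamond. -/
theorem exists_of_mem_tipPairs {s t : V} (h : s(s, t) ∈ tipPairs G) :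
    s ≠ t ∧ ¬ G.Adj s t ∧ ∃ w x, G.Adj w x ∧ G.Adj w s ∧ G.Adj w t ∧ G.Adj x s ∧ G.Adj x t := by
  obtain ⟨u, v, he, hne, hnadj, w, A, hA, K, S, hKS, hu, hv⟩ := h
  have huA : u ∈ A := hKS.union_eq ▸ Or.inr hu
  have hvA : v ∈ A := hKS.union_eq ▸ Or.inr hv
  obtain ⟨x, hxA, hux⟩ : ∃ x ∈ A, G.Adj u x := by
    by_contra! hcon
    have := localComponents_induction hA (p := fun y => y = u) huA rfl
      (by rintro y - z hz rfl hyz; exact (hcon z hz hyz).elim) v hvA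
    exact hne this.symm
  have hxK : x ∈ K := by
    have : x ∈ K ∪ S := hKS.union_eq ▸ hxA
    exact this.resolve_right fun hxS => hKS.isIndepSet hu hxS hux.ne hux
  have key : ∃ w x, G.Adj w x ∧ G.Adj w u ∧ G.Adj w v ∧ G.Adj x u ∧ G.Adj x v :=
    ⟨w, x, adj_of_mem_localComponents hA hxA, adj_of_mem_localComponents hA huA,
      adj_of_mem_localComponents hA hvA, hKS.complete x hxK u hu, hKS.complete x hxK v hv⟩
  rcases Sym2.eq_iff.1 he with ⟨rfl, rfl⟩ | ⟨rfl, rfl⟩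
  · exact ⟨hne, hnadj, key⟩
  · refine ⟨hne.symm, fun h => hnadj h.symm, ?_⟩
    obtain ⟨w, x, h1, h2, h3, h4, h5⟩ := key
    exact ⟨w, x, h1, h3, h2, h5, h4⟩

/-- Nonadjacent vertices lie in the independent part of every complete split partition. -/
theorem IsCompleteSplitPartition.mem_of_not_adj {A K S : Set V}
    (h : IsCompleteSplitPartition G A K S) {s t : V} (hs : s ∈ A) (ht : t ∈ A) (hne : s ≠ t)
    (hn : ¬ G.Adj s t) : s ∈ S := by
  rw [← h.union_eq] at hs ht
  rcases hs with hs | hs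
  · rcases ht with ht | ht
    · exact (hn (h.isClique hs ht hne)).elim
    · exact (hn (h.complete s hs t ht)).elim
  · exact hs

theorem IsLUCS.mem_tipPairs (hG : IsLUCS G) {s t w x : V} (hne : s ≠ t) (hn : ¬ G.Adj s t)
    (hwx : G.Adj w x) (hws : G.Adj w s) (hwt : G.Adj w t) (hxs : G.Adj x s) (hxt : G.Adj x t) :
    s(s, t) ∈ tipPairs G := by
  obtain ⟨A, hA, hxA⟩ := exists_mem_localComponents hwx
  obtain ⟨K, S, hKS⟩ := hG w A hA
  have hsA := mem_of_adj_of_mem_localComponents hA hxA hws hxs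
  have htA := mem_of_adj_of_mem_localComponents hA hxA hwt hxt
  exact ⟨s, t, rfl, hne, hn, w, A, hA, K, S, hKS, hKS.mem_of_not_adj hsA htA hne hn,
    hKS.mem_of_not_adj htA hsA hne.symm fun h => hn h.symm⟩

theorem left_mem_tipSet {s t : V} (h : s(s, t) ∈ tipPairs G) : s ∈ tipSet G :=
  ⟨_, h, Sym2.mem_mk_left s t⟩

theorem right_mem_tipSet {s t : V} (h : s(s, t) ∈ tipPairs G) : t ∈ tipSet G :=
  ⟨_, h, Sym2.mem_mk_right s t⟩

theorem not_adj_of_mem_tipSet (hN : G.IsIndepSet (tipSet G)) {x y : V} (hx : x ∈ tipSet G)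
    (hy : y ∈ tipSet G) : ¬ G.Adj x y :=
  fun h => hN hx hy h.ne h

/-- The graph obtained from `G` by adding all tip pairs as edges. -/
def tipCompletion (G : SimpleGraph V) : SimpleGraph V := G ⊔ fromEdgeSet (tipPairs G)

theorem tipCompletion_adj {x y : V} :
    (tipCompletion G).Adj x y ↔ G.Adj x y ∨ s(x, y) ∈ tipPairs G := by
  rw [tipCompletion, sup_adj, fromEdgeSet_adj]
  exact or_congr_right ⟨fun h => h.1, fun h => ⟨h, (exists_of_mem_tipPairs h).1⟩⟩

theorem mem_tipPairs_of_tipCompletion_adj (hN : G.IsIndepSet (tipSet G)) {x y : V}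
    (h : (tipCompletion G).Adj x y) (hx : x ∈ tipSet G) (hy : y ∈ tipSet G) :
    s(x, y) ∈ tipPairs G :=
  (tipCompletion_adj.1 h).resolve_left (not_adj_of_mem_tipSet hN hx hy)

theorem adj_of_tipCompletion_adj {x y : V} (h : (tipCompletion G).Adj x y)
    (hxy : x ∉ tipSet G ∨ y ∉ tipSet G) : G.Adj x y :=
  (tipCompletion_adj.1 h).resolve_right fun h =>
    hxy.elim (· (left_mem_tipSet h)) (· (right_mem_tipSet h))

theorem IsLUCS.tipCompletion_adj_of_edge (hG : IsLUCS G) {s t w x : V} (hne : s ≠ t)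
    (hwx : G.Adj w x) (hws : G.Adj w s) (hwt : G.Adj w t) (hxs : G.Adj x s) (hxt : G.Adj x t) :
    (tipCompletion G).Adj s t := by
  rw [tipCompletion_adj]
  exact or_iff_not_imp_left.2 fun hn => hG.mem_tipPairs hne hn hwx hws hwt hxs hxt

/-- Two vertices that are joined to a common edge are adjacent if one of them has a neighbour
in the tip set. -/
theorem IsLUCS.adj_of_edge (hG : IsLUCS G) (hN : G.IsIndepSet (tipSet G)) {p q w x s : V}
    (hne : p ≠ q) (hwx : G.Adj w x) (hwp : G.Adj w p) (hwq : G.Adj w q) (hxp : G.Adj x p)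
    (hxq : G.Adj x q) (hs : s ∈ tipSet G) (hps : G.Adj p s) : G.Adj p q := by
  by_contra hn
  exact not_adj_of_mem_tipSet hN (left_mem_tipSet (hG.mem_tipPairs hne hn hwx hwp hwq hxp hxq))
    hs hps

/-- A common neighbour of a tip pair is adjacent or equal to each vertex of a middle edge. -/
theorem adj_middle_of_mem_tipPairs (hG : IsLUCS G) (hF : IsFree coP3K2 G)
    (hN : G.IsIndepSet (tipSet G)) {s t w x d : V} (h : s(s, t) ∈ tipPairs G)
    (hwx : G.Adj w x) (hws : G.Adj w s) (hwt : G.Adj w t) (hxs : G.Adj x s) (hxt : G.Adj x t)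
    (hds : G.Adj d s) (hdt : G.Adj d t) (hdw : d ≠ w) : G.Adj d w := by
  have hst := exists_of_mem_tipPairs h
  by_contra hn
  have hdx : d ≠ x := by rintro rfl; exact hn hwx.symm
  by_cases hdx' : G.Adj d x
  · exact hn (hG.adj_of_edge hN hdw hxs hdx'.symm hwx.symm hds.symm hws.symm
      (left_mem_tipSet h) hds)
  · exact hF (coP3K2_isIndContained hwx hdw hdx hn hdx' hst.1 hst.2.1 ⟨hws, hds, hxs⟩
      ⟨hwt, hdt, hxt⟩)

/-- The common neighbours of a tip pair form a clique. -/
theorem adj_of_commonNeighbors (hG : IsLUCS G) (hF : IsFree coP3K2 G)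
    (hN : G.IsIndepSet (tipSet G)) {s t d e : V} (h : s(s, t) ∈ tipPairs G)
    (hds : G.Adj d s) (hdt : G.Adj d t) (hes : G.Adj e s) (het : G.Adj e t) (hde : d ≠ e) :
    G.Adj d e := by
  obtain ⟨-, -, w, x, hwx, hws, hwt, hxs, hxt⟩ := exists_of_mem_tipPairs h
  by_cases hdw : d = w
  · subst hdw
    exact (adj_middle_of_mem_tipPairs hG hF hN h hwx hws hwt hxs hxt hes het hde.symm).symm
  by_cases hew : e = w
  · subst hew
    exact adj_middle_of_mem_tipPairs hG hF hN h hwx hws hwt hxs hxt hds hdt hde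
  exact hG.adj_of_edge hN hde hws
    (adj_middle_of_mem_tipPairs hG hF hN h hwx hws hwt hxs hxt hds hdt hdw).symm
    (adj_middle_of_mem_tipPairs hG hF hN h hwx hws hwt hxs hxt hes het hew).symm
    hds.symm hes.symm (left_mem_tipSet h) hds

/-- A common neighbour of a tip pair has a further neighbour adjacent to both tips. -/
theorem exists_adj_commonNeighbor (hG : IsLUCS G) (hF : IsFree coP3K2 G)
    (hN : G.IsIndepSet (tipSet G)) {s t d : V} (h : s(s, t) ∈ tipPairs G)
    (hds : G.Adj d s) (hdt : G.Adj d t) : ∃ y, G.Adj d y ∧ G.Adj y s ∧ G.Adj y t := by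
  obtain ⟨-, -, w, x, hwx, hws, hwt, hxs, hxt⟩ := exists_of_mem_tipPairs h
  by_cases hdw : d = w
  · subst hdw; exact ⟨x, hwx, hxs, hxt⟩
  · exact ⟨w, adj_of_commonNeighbors hG hF hN h hds hdt hws hwt hdw, hws, hwt⟩

/-- A common neighbour of a tip pair has both tips in one component of its neighbourhood. -/
theorem mem_localComponent_of_mem_tipPairs (hG : IsLUCS G) (hF : IsFree coP3K2 G)
    (hN : G.IsIndepSet (tipSet G)) {s t d : V} (h : s(s, t) ∈ tipPairs G)
    (hds : G.Adj d s) (hdt : G.Adj d t) {A : Set V} (hA : A ∈ localComponents G d)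
    (hs : s ∈ A) : t ∈ A := by
  obtain ⟨y, hdy, hys, hyt⟩ := exists_adj_commonNeighbor hG hF hN h hds hdt
  exact mem_of_adj_of_mem_localComponents hA
    (mem_of_adj_of_mem_localComponents hA hs hdy hys.symm) hdt hyt

/-! ### The auxiliary bipartite graph -/

section aux

variable [Fintype V] {φ : V ≃ Fin (Fintype.card V)}

theorem IsRepresented.adj {v w : V} {S : Set V} (h : IsRepresented G φ v w S) : G.Adj v w := by
  obtain ⟨A, hA, K, hKS, -, -, hw, -⟩ := h
  exact adj_of_mem_localComponents hA (hKS.union_eq ▸ Or.inl hw)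

theorem IsRepresented.adj_left {v w s : V} {S : Set V} (h : IsRepresented G φ v w S)
    (hs : s ∈ S) : G.Adj v s := by
  obtain ⟨A, hA, K, hKS, -⟩ := h
  exact adj_of_mem_localComponents hA (hKS.union_eq ▸ Or.inr hs)

theorem IsRepresented.adj_right {v w s : V} {S : Set V} (h : IsRepresented G φ v w S)
    (hs : s ∈ S) : G.Adj w s := by
  obtain ⟨A, hA, K, hKS, -, -, hw, -⟩ := h
  exact hKS.complete w hw s hs

theorem IsRepresented.subset_tipSet {v w : V} {S : Set V} (h : IsRepresented G φ v w S) :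
    S ⊆ tipSet G := by
  obtain ⟨A, hA, K, hKS, hS, -⟩ := h
  intro s hs
  obtain ⟨t, ht, hne⟩ : ∃ t ∈ S, t ≠ s := by
    by_contra! hcon
    exact hS (Set.encard_eq_one.2 ⟨s, Set.eq_singleton_iff_unique_mem.2 ⟨hs, hcon⟩⟩)
  exact left_mem_tipSet ⟨s, t, rfl, hne.symm, hKS.isIndepSet hs ht hne.symm, v, A, hA, K, S, hKS,
    hs, ht⟩

/-- Every tip pair lies in a represented independent part. -/
theorem exists_isRepresented (hG : IsLUCS G) {s t : V} (h : s(s, t) ∈ tipPairs G) :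
    ∃ v w S, IsRepresented G φ v w S ∧ s ∈ S ∧ t ∈ S := by
  obtain ⟨hne, hn, w, x, hwx, hws, hwt, hxs, hxt⟩ := exists_of_mem_tipPairs h
  have hmin : ∀ Q : Set V, Q.Nonempty → ∃ v ∈ Q, ∀ x ∈ Q, φ v ≤ φ x := fun Q hQ =>
    Set.exists_min_image Q φ Q.toFinite hQ
  -- `v` is the first of the common neighbours.
  obtain ⟨v, ⟨y, hvy, hvs, hvt, hys, hyt⟩, hv⟩ :=
    hmin {v | ∃ y, G.Adj v y ∧ G.Adj v s ∧ G.Adj v t ∧ G.Adj y s ∧ G.Adj y t}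
      ⟨w, x, hwx, hws, hwt, hxs, hxt⟩
  obtain ⟨A, hA, hyA⟩ := exists_mem_localComponents hvy
  obtain ⟨K, S, hKS⟩ := hG v A hA
  have hsA := mem_of_adj_of_mem_localComponents hA hyA hvs hys
  have htA := mem_of_adj_of_mem_localComponents hA hyA hvt hyt
  have hsS := hKS.mem_of_not_adj hsA htA hne hn
  have htS := hKS.mem_of_not_adj htA hsA hne.symm fun h => hn h.symm
  have hyK : y ∈ K := by
    have : y ∈ K ∪ S := hKS.union_eq ▸ hyA
    exact this.resolve_right fun hyS => hKS.isIndepSet hyS hsS hys.ne hys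
  obtain ⟨z, hzK, hz⟩ := hmin K ⟨y, hyK⟩
  refine ⟨v, z, S, ⟨A, hA, K, hKS, ?_, fun x hx => ?_, hzK, hz⟩, hsS, htS⟩
  · intro h1
    obtain ⟨u, rfl⟩ := Set.encard_eq_one.1 h1
    exact hne (hsS.trans htS.symm)
  · have hvx := adj_of_mem_localComponents hA (hKS.union_eq.subset (Or.inl hx))
    exact lt_of_le_of_ne
      (hv x ⟨v, hvx.symm, hKS.complete x hx s hsS, hKS.complete x hx t htS, hvs, hvt⟩)
      (φ.injective.ne hvx.ne)

/-- Three mutual tip pairs are joined to a common edge. -/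
theorem exists_edge_of_tip_triangle (hG : IsLUCS G)
    (hB : IsFree (cycleGraph 6) (auxGraph G φ)) {p : Fin 3 → V}
    (hp : ∀ i j, i ≠ j → s(p i, p j) ∈ tipPairs G) :
    ∃ v w, G.Adj v w ∧ ∀ i, G.Adj v (p i) ∧ G.Adj w (p i) := by
  by_contra! hcon
  have hrep : ∀ i : Fin 3, ∃ a : auxA G φ, ∃ S, IsRepresented G φ a.1.1 a.1.2 S ∧
      ∀ j, i ≠ j → p j ∈ S := by
    intro i
    have h12 : ∀ i : Fin 3, i + 1 ≠ i + 2 := by decide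
    obtain ⟨v, w, S, hS, h1, h2⟩ := exists_isRepresented (φ := φ) hG (hp _ _ (h12 i))
    refine ⟨⟨(v, w), S, hS⟩, S, hS, fun j hij => ?_⟩
    have : ∀ i j : Fin 3, i ≠ j → j = i + 1 ∨ j = i + 2 := by decide
    rcases this i j hij with rfl | rfl <;> assumption
  choose a S hS hpS using hrep
  have hpN : ∀ j, p j ∈ auxN G φ := fun j =>
    ⟨_, _, _, hS (j + 1), hpS _ _ (by revert j; decide)⟩
  refine hB (cycleGraph_six_isIndContained_auxGraph_iff.2
    ⟨a, fun j => ⟨p j, hpN j⟩, fun i j => ⟨?_, fun hij => ⟨S i, hS i, hpS i j hij⟩⟩⟩)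
  rintro ⟨T, hT, hiT⟩ rfl
  obtain ⟨k, hk⟩ := hcon _ _ (hS i).adj
  by_cases hik : i = k
  · subst hik
    exact hk (hT.adj_left hiT) (hT.adj_right hiT)
  · exact hk ((hS i).adj_left (hpS i k hik)) ((hS i).adj_right (hpS i k hik))

/-! ### Sufficiency -/

theorem isFree_diamond_tipCompletion (hG : IsLUCS G) (hF : IsFree coP3K2 G)
    (hN : G.IsIndepSet (tipSet G)) (hB : IsFree (cycleGraph 6) (auxGraph G φ)) :
    IsFree diamond (tipCompletion G) := by
  intro hD
  obtain ⟨a, b, c, d, hne, hab, hac, had, hbc, hbd, hcd⟩ := diamond_isIndContained_iff.1 hD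
  have hab' : ¬ G.Adj a b := fun h => hab (tipCompletion_adj.2 (.inl h))
  -- It is enough to find a common edge joined to both tips.
  have edge : ∀ {w x}, G.Adj w x → G.Adj w a → G.Adj w b → G.Adj x a → G.Adj x b → False :=
    fun h1 h2 h3 h4 h5 => hab (hG.tipCompletion_adj_of_edge hne h1 h2 h3 h4 h5)
  -- Tips lying in one component of a neighbourhood form a tip pair.
  have comp : ∀ {v A}, A ∈ localComponents G v → a ∈ A → b ∈ A → False := by
    intro v A hA ha hb
    obtain ⟨K, S, hKS⟩ := hG v A hA
    exact hab (tipCompletion_adj.2 (.inr ⟨a, b, rfl, hne, hab', v, A, hA, K, S, hKS,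
      hKS.mem_of_not_adj ha hb hne hab',
      hKS.mem_of_not_adj hb ha hne.symm fun h => hab' h.symm⟩))
  have tri : ∀ {p c d}, p ∈ tipSet G → c ∈ tipSet G → d ∈ tipSet G →
      (tipCompletion G).Adj p c → (tipCompletion G).Adj p d → (tipCompletion G).Adj c d →
      ∃ v w, G.Adj v w ∧ (G.Adj v p ∧ G.Adj w p) ∧ (G.Adj v c ∧ G.Adj w c) ∧
        (G.Adj v d ∧ G.Adj w d) := by
    intro p c d hp hc hd h1 h2 h3
    have := mem_tipPairs_of_tipCompletion_adj hN h1 hp hc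
    have := mem_tipPairs_of_tipCompletion_adj hN h2 hp hd
    have := mem_tipPairs_of_tipCompletion_adj hN h3 hc hd
    obtain ⟨v, w, hvw, h⟩ := exists_edge_of_tip_triangle hG hB (p := ![p, c, d]) (by
      intro i j hij
      fin_cases i <;> fin_cases j <;> simp_all [Sym2.eq_swap])
    exact ⟨v, w, hvw, h 0, h 1, h 2⟩
  -- One tip and one middle vertex in the tip set, the other middle vertex not.
  have mixed : ∀ {a b c d}, (∀ {v A}, A ∈ localComponents G v → a ∈ A → b ∈ A → False) →
      a ∈ tipSet G → c ∈ tipSet G → d ∉ tipSet G → (tipCompletion G).Adj a c →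
      (tipCompletion G).Adj a d → (tipCompletion G).Adj b c → (tipCompletion G).Adj b d →
      (tipCompletion G).Adj c d → False := by
    intro a b c d comp ha hc hd hac had hbc hbd hcd
    have hda := (adj_of_tipCompletion_adj had (.inr hd)).symm
    have hdb := (adj_of_tipCompletion_adj hbd (.inr hd)).symm
    have hdc := (adj_of_tipCompletion_adj hcd (.inr hd)).symm
    obtain ⟨A, hA, haA⟩ := exists_mem_localComponents hda
    have hcA := mem_localComponent_of_mem_tipPairs hG hF hN
      (mem_tipPairs_of_tipCompletion_adj hN hac ha hc) hda hdc hA haA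
    refine comp hA haA ?_
    by_cases hb : b ∈ tipSet G
    · exact mem_localComponent_of_mem_tipPairs hG hF hN
        (mem_tipPairs_of_tipCompletion_adj hN hbc.symm hc hb) hdc hdb hA hcA
    · exact mem_of_adj_of_mem_localComponents hA hcA hdb
        (adj_of_tipCompletion_adj hbc (.inl hb)).symm
  -- Both middle vertices and one tip in the tip set.
  have full : ∀ {a b}, (∀ {w x}, G.Adj w x → G.Adj w a → G.Adj w b → G.Adj x a → G.Adj x b →
      False) → ¬ G.Adj a b → a ∈ tipSet G → c ∈ tipSet G → d ∈ tipSet G →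
      (tipCompletion G).Adj a c → (tipCompletion G).Adj a d → (tipCompletion G).Adj b c →
      (tipCompletion G).Adj b d → False := by
    intro a b edge hab ha hc hd hac had hbc hbd
    have hcdF := mem_tipPairs_of_tipCompletion_adj hN hcd hc hd
    obtain ⟨v, w, hvw, ⟨hva, hwa⟩, ⟨hvc, hwc⟩, ⟨hvd, hwd⟩⟩ := tri ha hc hd hac had hcd
    have hb : ∀ {v}, G.Adj v a → G.Adj v c → G.Adj v d → G.Adj v b := by
      intro v hva hvc hvd
      by_cases hbN : b ∈ tipSet G
      · obtain ⟨x, y, hxy, ⟨hxb, hyb⟩, ⟨hxc, hyc⟩, ⟨hxd, hyd⟩⟩ := tri hbN hc hd hbc hbd hcd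
        by_cases hvx : v = x
        · exact hvx ▸ hxb
        by_cases hvy : v = y
        · exact hvy ▸ hyb
        have hvb : v ≠ b := by
          rintro rfl
          exact not_adj_of_mem_tipSet hN hbN hc hvc
        exact hG.adj_of_edge hN hvb hxy
          (adj_of_commonNeighbors hG hF hN hcdF hvc hvd hxc hxd hvx).symm hxb
          (adj_of_commonNeighbors hG hF hN hcdF hvc hvd hyc hyd hvy).symm hyb hc hvc
      · refine adj_of_commonNeighbors hG hF hN hcdF hvc hvd
          (adj_of_tipCompletion_adj hbc (.inl hbN)) (adj_of_tipCompletion_adj hbd (.inl hbN)) ?_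
        rintro rfl
        exact hab hva.symm
    exact edge hvw hva (hb hva hvc hvd) hwa (hb hwa hwc hwd)
  have comp' : ∀ {v A}, A ∈ localComponents G v → b ∈ A → a ∈ A → False :=
    fun hA hb ha => comp hA ha hb
  have edge' : ∀ {w x}, G.Adj w x → G.Adj w b → G.Adj w a → G.Adj x b → G.Adj x a → False :=
    fun h1 h2 h3 h4 h5 => edge h1 h3 h2 h5 h4
  by_cases hc : c ∈ tipSet G <;> by_cases hd : d ∈ tipSet G
  · by_cases ha : a ∈ tipSet G
    · exact full edge hab' ha hc hd hac had hbc hbd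
    by_cases hb : b ∈ tipSet G
    · exact full edge' (fun h => hab' h.symm) hb hc hd hbc hbd hac had
    exact hab' (adj_of_commonNeighbors hG hF hN
      (mem_tipPairs_of_tipCompletion_adj hN hcd hc hd) (adj_of_tipCompletion_adj hac (.inl ha))
      (adj_of_tipCompletion_adj had (.inl ha)) (adj_of_tipCompletion_adj hbc (.inl hb))
      (adj_of_tipCompletion_adj hbd (.inl hb)) hne)
  · by_cases ha : a ∈ tipSet G
    · exact mixed comp ha hc hd hac had hbc hbd hcd
    by_cases hb : b ∈ tipSet G
    · exact mixed comp' hb hc hd hbc hbd hac had hcd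
    exact edge (adj_of_tipCompletion_adj hcd (.inr hd))
      (adj_of_tipCompletion_adj hac (.inl ha)).symm (adj_of_tipCompletion_adj hbc (.inl hb)).symm
      (adj_of_tipCompletion_adj had (.inl ha)).symm (adj_of_tipCompletion_adj hbd (.inl hb)).symm
  · by_cases ha : a ∈ tipSet G
    · exact mixed comp ha hd hc had hac hbd hbc hcd.symm
    by_cases hb : b ∈ tipSet G
    · exact mixed comp' hb hd hc hbd hbc had hac hcd.symm
    exact edge (adj_of_tipCompletion_adj hcd (.inl hc))
      (adj_of_tipCompletion_adj hac (.inl ha)).symm (adj_of_tipCompletion_adj hbc (.inl hb)).symm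
      (adj_of_tipCompletion_adj had (.inl ha)).symm (adj_of_tipCompletion_adj hbd (.inl hb)).symm
  · exact edge (adj_of_tipCompletion_adj hcd (.inr hd))
      (adj_of_tipCompletion_adj hac (.inr hc)).symm (adj_of_tipCompletion_adj hbc (.inr hc)).symm
      (adj_of_tipCompletion_adj had (.inr hd)).symm (adj_of_tipCompletion_adj hbd (.inr hd)).symm

end aux

theorem isProbeDiamondFree_of_isFree_tipCompletion (hN : G.IsIndepSet (tipSet G))
    (h : IsFree diamond (tipCompletion G)) : IsProbeDiamondFree G := by
  refine ⟨(tipSet G)ᶜ, tipSet G, Set.compl_union_self _, disjoint_compl_left, hN, tipPairs G,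
    fun e he => ⟨?_, ?_, fun x hx => ⟨e, he, hx⟩⟩, h⟩
  · obtain ⟨u, v, rfl, hne, -⟩ := he
    simpa using hne
  · obtain ⟨u, v, rfl, -, hn, -⟩ := he
    simpa using hn

/-! ### Necessity -/

section necessity

variable {G' : SimpleGraph V} {N : Set V}

theorem IsFree.diamond_adj (h : IsFree diamond G') {a b c d : V} (hne : a ≠ b)
    (hac : G'.Adj a c) (had : G'.Adj a d) (hbc : G'.Adj b c) (hbd : G'.Adj b d)
    (hcd : G'.Adj c d) : G'.Adj a b := by
  by_contra hab
  exact h (diamond_isIndContained_iff.2 ⟨a, b, c, d, hne, hab, hac, had, hbc, hbd, hcd⟩)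

theorem isClique_localComponent (h : IsFree diamond G') (hle : G ≤ G') {v : V} {A : Set V}
    (hA : A ∈ localComponents G v) : G'.IsClique A := by
  intro x hx y hy hne
  refine (localComponents_induction hA (p := fun y => x = y ∨ G'.Adj x y) hx (.inl rfl) ?_ y
    hy).resolve_left hne
  rintro y hy z hz (rfl | hxy) hyz
  · exact .inr (hle hyz)
  · by_cases hxz : x = z
    · exact .inl hxz
    · exact .inr (h.diamond_adj hxz hxy (hle (adj_of_mem_localComponents hA hx)).symm
        (hle hyz).symm (hle (adj_of_mem_localComponents hA hz)).symm
        (hle (adj_of_mem_localComponents hA hy)).symm)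

theorem isLUCS_of_isFree_diamond (h : IsFree diamond G') (hle : G ≤ G') (hN : G.IsIndepSet N)
    (hG' : ∀ {x y}, G'.Adj x y → G.Adj x y ∨ x ∈ N ∧ y ∈ N) : IsLUCS G := by
  intro v A hA
  have hcl := isClique_localComponent h hle hA
  by_cases hne : (A ∩ N).Nonempty
  · refine ⟨A \ N, A ∩ N, Set.sdiff_union_inter A N,
      Set.disjoint_left.2 fun x hx hx' => hx.2 hx'.2, fun x hx y hy hxy => ?_,
      fun x hx y hy => hN hx.2 hy.2, fun T hTA hT => ?_, fun x hx y hy => ?_⟩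
    · exact (hG' (hcl hx.1 hy.1 hxy)).resolve_right fun h => hx.2 h.1
    · by_cases hs : T.Subsingleton
      · exact (Set.encard_le_one_iff_subsingleton.2 hs).trans (Set.one_le_encard_iff_nonempty.2 hne)
      · refine Set.encard_le_encard fun x hx => ⟨hTA hx, ?_⟩
        obtain ⟨y, hy, hxy⟩ := (Set.not_subsingleton_iff.1 hs).exists_ne x
        exact ((hG' (hcl (hTA hx) (hTA hy) hxy.symm)).resolve_left (hT hx hy hxy.symm)).1
    · exact (hG' (hcl hx.1 hy.1 fun e => hx.2 (e ▸ hy.2))).resolve_right fun h => hx.2 h.1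
  · have hclG : G.IsClique A := fun x hx y hy hxy =>
      (hG' (hcl hx hy hxy)).resolve_right fun h => hne ⟨x, hx, h.1⟩
    obtain ⟨x, hx⟩ := nonempty_of_mem_localComponents hA
    refine ⟨A \ {x}, {x}, Set.sdiff_union_of_subset (by simpa using hx),
      Set.disjoint_sdiff_left, hclG.subset Set.sdiff_subset, by simp [IsIndepSet],
      fun T hTA hT => ?_, ?_⟩
    · rw [Set.encard_singleton, Set.encard_le_one_iff]
      intro y z hy hz
      by_contra hyz
      exact hT hy hz hyz (hclG (hTA hy) (hTA hz) hyz)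
    · rintro y ⟨hy, hyx⟩ _ rfl
      exact hclG hy hx hyx

theorem isFree_coP3K2_of_isFree_diamond (h : IsFree diamond G') (hle : G ≤ G')
    (hN : G.IsIndepSet N) (hG' : ∀ {x y}, G'.Adj x y → G.Adj x y ∨ x ∈ N ∧ y ∈ N) :
    IsFree coP3K2 G := by
  intro hc
  obtain ⟨a, b, d, e, hne, hab, hde, hde', had, hae, hbd, hbe, c, hca, hcd, hce⟩ :=
    exists_of_coP3K2_isIndContained hc
  have hdeG := h.diamond_adj hde' (hle had.symm) (hle hcd.symm) (hle hae.symm) (hle hce.symm)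
    (hle hca.symm)
  have habG := h.diamond_adj hne (hle had) (hle hae) (hle hbd) (hle hbe) hdeG
  exact hN ((hG' habG).resolve_left hab).1 ((hG' hdeG).resolve_left hde).1 had.ne had

theorem adj_of_mem_tipPairs (h : IsFree diamond G') (hle : G ≤ G') {s t : V}
    (hst : s(s, t) ∈ tipPairs G) : G'.Adj s t := by
  obtain ⟨hne, -, w, x, hwx, hws, hwt, hxs, hxt⟩ := exists_of_mem_tipPairs hst
  exact h.diamond_adj hne (hle hws.symm) (hle hxs.symm) (hle hwt.symm) (hle hxt.symm) (hle hwx)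

theorem tipSet_subset (h : IsFree diamond G') (hle : G ≤ G')
    (hG' : ∀ {x y}, G'.Adj x y → G.Adj x y ∨ x ∈ N ∧ y ∈ N) : tipSet G ⊆ N := by
  rintro x ⟨e, he, hx⟩
  obtain ⟨y, rfl⟩ := Sym2.mem_iff_exists.1 hx
  exact ((hG' (adj_of_mem_tipPairs h hle he)).resolve_left (exists_of_mem_tipPairs he).2.1).1

theorem isFree_cycleGraph_six_auxGraph [Fintype V] {φ : V ≃ Fin (Fintype.card V)}
    (h : IsFree diamond G') (hle : G ≤ G') (hN : G.IsIndepSet N)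
    (hG' : ∀ {x y}, G'.Adj x y → G.Adj x y ∨ x ∈ N ∧ y ∈ N) :
    IsFree (cycleGraph 6) (auxGraph G φ) := by
  intro hC
  obtain ⟨a, s, has⟩ := cycleGraph_six_isIndContained_auxGraph_iff.1 hC
  have hLUCS := isLUCS_of_isFree_diamond h hle hN hG'
  have hs : ∀ i, (s i).1 ∈ N := by
    intro i
    obtain ⟨S, hS, hiS⟩ := (has (i + 1) i).2 (by revert i; decide)
    exact tipSet_subset h hle hG' (hS.subset_tipSet hiS)
  have hadj : ∀ {i j}, i ≠ j → G'.Adj (s i).1 (s j).1 := by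
    intro i j hij
    have hne : (s i).1 ≠ (s j).1 := fun e =>
      (has i i).1 (Subtype.ext e ▸ (has i j).2 hij) rfl
    obtain ⟨k, hki, hkj⟩ : ∃ k : Fin 3, k ≠ i ∧ k ≠ j := by
      clear hne; revert i j; decide
    obtain ⟨S, hS, hiS⟩ := (has k i).2 hki
    obtain ⟨T, hT, hjT⟩ := (has k j).2 hkj
    exact adj_of_mem_tipPairs h hle (hLUCS.mem_tipPairs hne (hN (hs i) (hs j) hne) hS.adj
      (hS.adj_left hiS) (hT.adj_left hjT) (hS.adj_right hiS) (hT.adj_right hjT))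
  have key : ∀ {x}, G.Adj x (s 1).1 → G.Adj x (s 2).1 → G.Adj x (s 0).1 := by
    intro x h1 h2
    have hxN : x ∉ N := fun hx => hN hx (hs 1) h1.ne h1
    have hx0 : x ≠ (s 0).1 := fun e => hxN (e ▸ hs 0)
    exact (hG' (h.diamond_adj hx0 (hle h1) (hle h2) (hadj (by decide)) (hadj (by decide))
      (hadj (by decide)))).resolve_right fun h => hxN h.1
  obtain ⟨S, hS, h1S⟩ := (has 0 1).2 (by decide)
  obtain ⟨T, hT, h2T⟩ := (has 0 2).2 (by decide)
  have hv := key (hS.adj_left h1S) (hT.adj_left h2T)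
  have hw := key (hS.adj_right h1S) (hT.adj_right h2T)
  refine (has 0 0).1 ⟨S, hS, ?_⟩ rfl
  obtain ⟨A, hA, K, hKS, -, -, hwK, -⟩ := id hS
  have h0A := mem_of_adj_of_mem_localComponents hA (hKS.union_eq.subset (Or.inl hwK)) hv hw
  have h01 := hadj (i := 0) (j := 1) (by decide)
  exact hKS.mem_of_not_adj h0A (hKS.union_eq.subset (Or.inr h1S)) h01.ne
    (hN (hs 0) (hs 1) h01.ne)

end necessity

end ProbeDiamond

theorem mainTheorem1 {V : Type*} [Fintype V] (G : SimpleGraph V)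
    (φ : V ≃ Fin (Fintype.card V)) :
    ProbeDiamond.IsProbeDiamondFree G ↔
      ProbeDiamond.IsLUCS G ∧
      ProbeDiamond.IsFree ProbeDiamond.coP3K2 G ∧
      G.IsIndepSet (ProbeDiamond.tipSet G) ∧
      ProbeDiamond.IsFree (SimpleGraph.cycleGraph 6) (ProbeDiamond.auxGraph G φ) := by
  constructor
  · rintro ⟨P, N, -, -, hN, F, hF, h⟩
    have hle : G ≤ G ⊔ SimpleGraph.fromEdgeSet F := le_sup_left
    have hG' : ∀ {x y}, (G ⊔ SimpleGraph.fromEdgeSet F).Adj x y → G.Adj x y ∨ x ∈ N ∧ y ∈ N := by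
      rintro x y (hxy | hxy)
      · exact .inl hxy
      · have := (hF _ ((SimpleGraph.fromEdgeSet_adj _).1 hxy).1).2.2
        exact .inr ⟨this x (Sym2.mem_mk_left x y), this y (Sym2.mem_mk_right x y)⟩
    exact ⟨ProbeDiamond.isLUCS_of_isFree_diamond h hle hN hG',
      ProbeDiamond.isFree_coP3K2_of_isFree_diamond h hle hN hG',
      hN.mono (ProbeDiamond.tipSet_subset h hle hG'),
      ProbeDiamond.isFree_cycleGraph_six_auxGraph h hle hN hG'⟩
  · rintro ⟨hG, hF, hN, hB⟩
    exact ProbeDiamond.isProbeDiamondFree_of_isFree_tipCompletion hN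
      (ProbeDiamond.isFree_diamond_tipCompletion hG hF hN hB)
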